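/- Let $\widetilde{\mathrm{Homeo}}_+(S^1)$ be the group of lifts to $\mathbb{R}$ of orientation-preserving homeomorphisms of the circle $S^1=\mathbb{R}/\mathbb{Z}$, that is, of increasing homeomorphisms $f:\mathbb{R}\to\mathbb{R}$ with $f(t+1)=f(t)+1$, and let $\mathrm{rot}^\sim(f)=\lim_{n\to\infty} f^n(0)/n$ be the translation number. For $x,y\in\mathbb{R}$ put $$R_{ab}(x,y)=\sup\{\mathrm{rot}^\sim(ab) \mid a,b\in\widetilde{\mathrm{Homeo}}_+(S^1),\ \mathrm{rot}^\sim(a)=x,\ \mathrm{rot}^\sim(b)=y\}.$$ Then $R_{ab}(x,y)$ is rational for all $x,y\in\mathbb{R}$. Moreover, for all $x,y\in\mathbb{R}$, the supremum in the Calegari--Walker formula $$R_{ab}(x,y)=\sup_{\frac{p_1}{q}\le x,\ \frac{p_2}{q}\le y}\frac{p_1+p_2+1}{q}$$ (over integers $p_1,p_2$ and $q\ge 1$) is attained, that is, $$R_{ab}(x,y)=\max\Big\{\frac{p_1+p_2+1}{q} \;\Big|\; p_1,p_2\in\mathbb{Z},\ q\in\mathbb{Z}_{\ge1},\ \frac{p_1}{q}\le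 x,\ \frac{p_2}{q}\le y\Big\}.$$ -/

import Mathlib

namespace Ziggurat

/-- The set of translation numbers of `a b`, where `a`, `b` range over the lifts to the line of
orientation-preserving circle homeomorphisms (that is, over the invertible elements of the monoid
of monotone degree one lifts) with translation numbers `x` and `y`. The product is composition. -/
def productTranslationNumbers (x y : ℝ) : Set ℝ :=
  {t | ∃ a b : CircleDeg1Liftˣ,
    CircleDeg1Lift.translationNumber (a : CircleDeg1Lift) = x ∧
    CircleDeg1Lift.translationNumber (b : CircleDeg1Lift) = y ∧
    CircleDeg1Lift.translationNumber ((a * b : CircleDeg1Liftˣ) : CircleDeg1Lift) = t}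

/-- `R_{ab}(x, y)`: the upper end of the set of translation numbers of `a b` for given translation
numbers `x` of `a` and `y` of `b`. -/
noncomputable def Rab (x y : ℝ) : ℝ :=
  sSup (productTranslationNumbers x y)

/-- The supremum defining `Rab` is one of a nonempty set that is bounded above. -/
theorem isLUB_Rab (x y : ℝ) : IsLUB (productTranslationNumbers x y) (Rab x y) := by
  refine isLUB_csSup ?_ ?_
  · exact ⟨_, CircleDeg1Lift.translate (Multiplicative.ofAdd x),
      CircleDeg1Lift.translate (Multiplicative.ofAdd y),
      CircleDeg1Lift.translationNumber_translate x,
      CircleDeg1Lift.translationNumber_translate y, rfl⟩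
  · refine ⟨x + y + 4, ?_⟩
    rintro t ⟨a, b, ha, hb, rfl⟩
    have h1 := (a : CircleDeg1Lift).dist_map_zero_translationNumber_le
    have h2 := (b : CircleDeg1Lift).dist_map_zero_translationNumber_le
    have h3 := ((a * b : CircleDeg1Liftˣ) : CircleDeg1Lift).dist_map_zero_translationNumber_le
    have h4 := CircleDeg1Lift.map_map_zero_lt (a : CircleDeg1Lift) (b : CircleDeg1Lift)
    rw [Real.dist_eq, abs_le] at h1 h2 h3
    rw [Units.val_mul, CircleDeg1Lift.mul_apply] at h3
    rw [Units.val_mul]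
    linarith [h1.2, h2.2, h3.1]

/-- The fractions `(p₁ + p₂ + 1) / q` over all integers `p₁`, `p₂` and `q ≥ 1` with
`p₁ / q ≤ x` and `p₂ / q ≤ y`. -/
def fractions (x y : ℝ) : Set ℝ :=
  {t | ∃ (p₁ p₂ : ℤ) (q : ℕ), 0 < q ∧ (p₁ : ℝ) / q ≤ x ∧ (p₂ : ℝ) / q ≤ y ∧
    t = ((p₁ : ℝ) + p₂ + 1) / q}

end Ziggurat

namespace Ziggurat

open CircleDeg1Lift

/-! ### Equivariant integer sequences, rates of growth, and the descent on the denominator -/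

section Discrete

/-! The proof bounds `Rab x y` from both sides by the fractions and shows separately that the
fractions have a maximum.

Upper bound. If `m / n < rot (a b)`, some sequence `ζ` of period `n` satisfies `ζ (i + m) ≤ a (b (ζ
i))`. Recording the last `b (ζ i)` below `ζ j` turns the dynamics into a monotone map of `ℤ`
commuting with translation by `n`, with rate controlled by `a`. Along a periodic orbit of this map,
`a` can be replaced by an index shift `p` with `p / k ≤ rot a`. What remains is a monotone integer
map `B` of period `k` with rate controlled by `b`, whose composition with the shift by `p + 1` still
has rate at least `(m / n) * k`.

The core is the descent `exists_mem_fractions_of_growth`. An integer map that is not a translation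
has a periodic orbit shorter than its period. Indexing by that orbit makes the map a shift and turns
the former shift into a new monotone map: the roles swap and the period drops. Once the map is a
translation, the composition has rate exactly `(s + p + 1) / q`, a fraction.

Lower bound. Two piecewise linear maps of period `1 / q`, each with a fixed point, can have a
product advancing some point by exactly `1 / q`. Composing with translations by `p₁ / q` and `p₂ /
q` realizes each fraction; raising the factors to translation numbers `x` and `y` can only raise the
product.

Maximum. A fraction of denominator `q` is at most `x + y + 1 / q`, so once some fraction exceeds `x
+ y` only finitely many `q` compete. Otherwise simultaneous approximation forces `x + y = ⌊x⌋ + ⌊y⌋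
+ 1`. -/

theorem map_add_int_mul {R : Type*} [Ring R] {u : ℤ → R} {k : ℤ} {d : R}
    (hu : ∀ i, u (i + k) = u i + d) (s i : ℤ) : u (i + s * k) = u i + s * d := by
  induction s using Int.induction_on with
  | zero => simp
  | succ n ih =>
    rw [add_mul, one_mul, ← add_assoc, hu, ih]
    push_cast
    noncomm_ring
  | pred n ih =>
    have h := hu (i + (-(n : ℤ) - 1) * k)
    rw [show i + (-(n : ℤ) - 1) * k + k = i + -(n : ℤ) * k by ring, ih] at h
    rw [← sub_eq_iff_eq_add] at h
    rw [← h]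
    push_cast
    noncomm_ring

/-- An equivariant monotone sequence stays at bounded distance from a linear one. -/
theorem exists_abs_mul_sub_mul_le {u : ℤ → ℝ} {k : ℤ} {d : ℝ} (hk : 0 < k) (hm : Monotone u)
    (hu : ∀ i, u (i + k) = u i + d) : ∃ C : ℝ, ∀ l : ℤ, |k * u l - d * l| ≤ C := by
  refine ⟨k * (|u 0| + |d|) + |d| * k, fun l => ?_⟩
  have hk' : (0 : ℝ) < k := by exact_mod_cast hk
  have h1 : u l = u (l % k) + (l / k : ℤ) * d := by
    rw [← map_add_int_mul hu, mul_comm, Int.emod_add_mul_ediv]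
  have h2 : (l : ℝ) = (l % k : ℤ) + k * (l / k : ℤ) := by
    exact_mod_cast (Int.emod_add_mul_ediv l k).symm
  have h3 : 0 ≤ l % k := Int.emod_nonneg _ hk.ne'
  have h4 : l % k ≤ k := (Int.emod_lt_of_pos _ hk).le
  have h5 : u 0 ≤ u (l % k) := hm h3
  have h6 : u (l % k) ≤ u 0 + d := by
    have := hm h4
    rwa [← zero_add k, hu, zero_add] at this
  have h3' : (0 : ℝ) ≤ (l % k : ℤ) := by exact_mod_cast h3
  have h4' : ((l % k : ℤ) : ℝ) ≤ k := by exact_mod_cast h4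
  have h7 : |u (l % k)| ≤ |u 0| + |d| := by
    rw [abs_le]
    constructor <;> linarith [neg_abs_le (u 0), le_abs_self (u 0), abs_nonneg d, le_abs_self d]
  have h8 : (k : ℝ) * u l - d * l = k * u (l % k) - d * (l % k : ℤ) := by
    rw [h1, h2]
    ring
  rw [h8]
  refine (abs_sub _ _).trans (add_le_add ?_ ?_)
  · rw [abs_mul, abs_of_pos hk']
    gcongr
  · rw [abs_mul, abs_of_nonneg h3']
    gcongr

/-- An equivariant monotone sequence has an upper adjoint. -/
theorem exists_upper_adjoint {u : ℤ → ℝ} {k : ℤ} {d : ℝ} (hk : 0 < k) (hd : 0 < d)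
    (hm : Monotone u) (hu : ∀ i, u (i + k) = u i + d) :
    ∃ g : ℝ → ℤ, ∀ i t, i ≤ g t ↔ u i ≤ t := by
  obtain ⟨C, hC⟩ := exists_abs_mul_sub_mul_le hk hm hu
  have hk' : (0 : ℝ) < k := by exact_mod_cast hk
  have key : ∀ t, ∃ g : ℤ, ∀ i, i ≤ g ↔ u i ≤ t := by
    intro t
    have hbdd : ∃ b : ℤ, ∀ z : ℤ, u z ≤ t → z ≤ b := by
      refine ⟨⌈(k * t + C) / d⌉, fun z hz => ?_⟩
      have h := (abs_le.1 (hC z)).1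
      have h' : (z : ℝ) ≤ (k * t + C) / d := by
        rw [le_div_iff₀ hd]
        nlinarith
      exact_mod_cast h'.trans (Int.le_ceil _)
    have hne : ∃ z : ℤ, u z ≤ t := by
      refine ⟨⌊(k * t - C) / d⌋, ?_⟩
      have h := (abs_le.1 (hC ⌊(k * t - C) / d⌋)).2
      have h' := Int.floor_le ((k * t - C) / d)
      rw [le_div_iff₀ hd] at h'
      have : (k : ℝ) * u ⌊(k * t - C) / d⌋ ≤ k * t := by linarith
      exact le_of_mul_le_mul_left this hk'
    obtain ⟨g, hg, hmax⟩ := Int.exists_greatest_of_bdd hbdd hne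
    exact ⟨g, fun i => ⟨fun hi => (hm hi).trans hg, hmax i⟩⟩
  choose g hg using key
  exact ⟨g, fun i t => hg t i⟩

/-- The upper adjoint of an equivariant sequence is equivariant. -/
theorem upper_adjoint_add {u : ℤ → ℝ} {k : ℤ} {d : ℝ} (hu : ∀ i, u (i + k) = u i + d)
    {g : ℝ → ℤ} (hg : ∀ i t, i ≤ g t ↔ u i ≤ t) (t : ℝ) : g (t + d) = g t + k := by
  refine eq_of_forall_le_iff fun i => ?_
  have h := hu (i - k)
  rw [sub_add_cancel] at h
  rw [hg, ← sub_le_iff_le_add (a := i), hg, h, add_le_add_iff_right]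

theorem upper_adjoint_mono {u : ℤ → ℝ} {g : ℝ → ℤ} (hg : ∀ i t, i ≤ g t ↔ u i ≤ t) :
    Monotone g :=
  fun _ _ h => (hg _ _).2 (((hg _ _).1 le_rfl).trans h)

/-- Some orbit of `A` grows at rate at most `r`. -/
def GrowthLE (A : ℤ → ℤ) (r : ℝ) : Prop :=
  ∃ (j : ℤ) (C : ℝ), ∀ N : ℕ, ((A^[N] j : ℤ) : ℝ) ≤ r * N + C

/-- Some orbit of `A` grows at rate at least `r`. -/
def GrowthGE (A : ℤ → ℤ) (r : ℝ) : Prop :=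
  ∃ (j : ℤ) (C : ℝ), ∀ N : ℕ, r * N - C ≤ ((A^[N] j : ℤ) : ℝ)

/-- Since `k * u l` and `d * l` differ by a bounded amount, a rate `r` for values of `u` is a rate
`r * k / d` for indices. -/
theorem growthLE_of_sequence {u : ℤ → ℝ} {k : ℤ} {d r C : ℝ} (hk : 0 < k) (hd : 0 < d)
    (hm : Monotone u) (hu : ∀ i, u (i + k) = u i + d) {B : ℤ → ℤ} {l : ℤ}
    (h : ∀ N : ℕ, u (B^[N] l) ≤ r * N + C) : GrowthLE B (r / d * k) := by
  obtain ⟨C', hC'⟩ := exists_abs_mul_sub_mul_le hk hm hu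
  refine ⟨l, (k * C + C') / d, fun N => ?_⟩
  have hk' : (0 : ℝ) < k := by exact_mod_cast hk
  have h1 := (abs_le.1 (hC' (B^[N] l))).1
  have h2 := mul_le_mul_of_nonneg_left (h N) hk'.le
  have h3 : r / d * k * N + (k * C + C') / d = (k * (r * N + C) + C') / d := by
    field_simp
    ring
  rw [h3, le_div_iff₀ hd]
  linarith

theorem growthGE_of_sequence {u : ℤ → ℝ} {k : ℤ} {d r C : ℝ} (hk : 0 < k) (hd : 0 < d)
    (hm : Monotone u) (hu : ∀ i, u (i + k) = u i + d) {B : ℤ → ℤ} {l : ℤ}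
    (h : ∀ N : ℕ, r * N - C ≤ u (B^[N] l)) : GrowthGE B (r / d * k) := by
  obtain ⟨C', hC'⟩ := exists_abs_mul_sub_mul_le hk hm hu
  refine ⟨l, (k * C + C') / d, fun N => ?_⟩
  have hk' : (0 : ℝ) < k := by exact_mod_cast hk
  have h1 := (abs_le.1 (hC' (B^[N] l))).2
  have h2 := mul_le_mul_of_nonneg_left (h N) hk'.le
  have h3 : r / d * k * N - (k * C + C') / d = (k * (r * N - C) - C') / d := by
    field_simp
    ring
  rw [h3, div_le_iff₀ hd]
  linarith

/-- Growth from below passes from `T ∘ B` to `B ∘ T` for a translation `T`. -/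
theorem GrowthGE.conj_translation {B : ℤ → ℤ} {r : ℝ} {s : ℤ}
    (h : GrowthGE (fun l => B l + s) r) : GrowthGE (fun l => B (l + s)) r := by
  obtain ⟨j, C, hC⟩ := h
  -- Shifted by `s`, the new orbit from `B j` is the old orbit from `j` one step ahead; `|r|` and
  -- `|s|` pay for the step and the shift.
  refine ⟨B j, C + |r| + |(s : ℝ)|, fun N => ?_⟩
  have key : ∀ N : ℕ, (fun l => B (l + s))^[N] (B j) + s = (fun l => B l + s)^[N + 1] j := by
    intro N
    induction N with
    | zero => simp
    | succ N ih =>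
      rw [Function.iterate_succ_apply', Function.iterate_succ_apply', ← ih]
  have h1 := hC (N + 1)
  rw [← key N] at h1
  push_cast at h1
  linarith [neg_abs_le r, le_abs_self (s : ℝ)]

/-- The rate of a periodic orbit is at most every upper rate of growth. -/
theorem GrowthLE.le_of_iterate_eq {A : ℤ → ℤ} {q k : ℕ} {x : ℝ} {j p : ℤ} (hq : 0 < q)
    (hk : 0 < k) (hm : Monotone A) (hA : ∀ i, A (i + q) = A i + q) (h : GrowthLE A (x * q))
    (hj : A^[k] j = j + p * q) : (p : ℝ) / k ≤ x := by
  obtain ⟨i, C, hC⟩ := h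
  have hq' : (0 : ℝ) < q := by exact_mod_cast hq
  have hk' : (0 : ℝ) < k := by exact_mod_cast hk
  have hiter : ∀ N : ℕ, ∀ l s : ℤ, A^[N] (l + s * q) = A^[N] l + s * q := by
    intro N
    induction N with
    | zero => simp
    | succ N ih =>
      intro l s
      rw [Function.iterate_succ_apply, Function.iterate_succ_apply, ← ih]
      congr 1
      simpa using map_add_int_mul hA s l
  have horbit : ∀ N : ℕ, A^[k * N] j = j + N * (p * q) := by
    intro N
    induction N with
    | zero => simp
    | succ N ih =>
      rw [Nat.mul_succ, add_comm, Function.iterate_add_apply, ih, ← mul_assoc, hiter, hj]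
      push_cast
      ring
  -- Moving the slow orbit above the periodic one lets monotonicity compare them.
  obtain ⟨s, hs⟩ : ∃ s : ℤ, j ≤ i + s * q := by
    refine ⟨|j - i|, ?_⟩
    have h1 := le_abs_self (j - i)
    have h2 := abs_nonneg (j - i)
    have h3 : (1 : ℤ) ≤ q := by exact_mod_cast hq
    nlinarith
  have hbound : ∀ N : ℕ, (N : ℝ) * (q * (p - x * k)) ≤ C + s * q - j := by
    intro N
    have h1 := hm.iterate (k * N) hs
    rw [hiter, horbit] at h1
    have h2 : (j : ℝ) + N * (p * q) ≤ ((A^[k * N] i : ℤ) : ℝ) + s * q := by exact_mod_cast h1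
    have h3 := hC (k * N)
    push_cast at h3
    linarith
  rw [div_le_iff₀ hk']
  by_contra! hlt
  have hpos : 0 < (q : ℝ) * (p - x * k) := mul_pos hq' (by linarith)
  obtain ⟨N, hN⟩ := exists_nat_gt ((C + s * q - j) / (q * (p - x * k)))
  rw [div_lt_iff₀ hpos] at hN
  linarith [hbound N]

/-- A monotone map of `ℤ` commuting with the translation by `q` is a translation, or it has a
periodic orbit modulo `q` with fewer than `q` elements. -/
theorem exists_translation_or_short_orbit {A : ℤ → ℤ} {q : ℕ} (hq : 0 < q) (hm : Monotone A)
    (hA : ∀ i, A (i + q) = A i + q) :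
    (∃ s, ∀ j, A j = j + s) ∨
      ∃ (k : ℕ) (j p : ℤ), 0 < k ∧ k < q ∧ A^[k] j = j + p * q := by
  have hqz : (0 : ℤ) < q := by exact_mod_cast hq
  have hA' : ∀ i, A i = A (i % q) + q * (i / q) := by
    intro i
    have := map_add_int_mul hA (i / q) (i % q)
    rw [mul_comm, Int.emod_add_mul_ediv] at this
    rw [this]
    simp [mul_comm]
  have hmod : ∀ i, A (i % q) % q = A i % q := by
    intro i
    rw [hA' i, Int.add_mul_emod_self_left]
  by_cases hs : ∀ i, A i + 1 ≤ A (i + 1)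
  · left
    have hstep : ∀ n : ℕ, ∀ i, A i + n ≤ A (i + n) := by
      intro n
      induction n with
      | zero => simp
      | succ n ih =>
        intro i
        have h1 := ih i
        have h2 := hs (i + n)
        push_cast
        rw [← add_assoc, ← add_assoc]
        omega
    have heq : ∀ i, A (i + 1) = A i + 1 := by
      intro i
      -- The other `q - 1` steps of the period use up at least `q - 1` of the total increase `q`.
      have h1 := hstep (q - 1) (i + 1)
      have h2 := hA i
      have h3 := hs i
      rw [Nat.cast_sub (by omega), Nat.cast_one, show i + 1 + ((q : ℤ) - 1) = i + q by ring, h2]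
        at h1
      omega
    refine ⟨A 0, fun j => ?_⟩
    have := map_add_int_mul heq j 0
    simp only [mul_one, zero_add, Int.cast_id] at this
    rw [this, add_comm]
  · right
    push Not at hs
    obtain ⟨i, hi⟩ := hs
    have hi' : A (i + 1) = A i := le_antisymm (by omega) (hm (by omega))
    set T : Finset ℤ := (Finset.Ico (0 : ℤ) q).image fun i => A i % q with hT
    have hmem : ∀ i, A i % q ∈ T := fun i =>
      Finset.mem_image.2 ⟨i % q, Finset.mem_Ico.2 ⟨Int.emod_nonneg _ hqz.ne',
        Int.emod_lt_of_pos _ hqz⟩, hmod i⟩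
    have hcard : T.card < (Finset.range q).card := by
      rw [Finset.card_range]
      refine lt_of_le_of_ne (Finset.card_image_le.trans (by simp)) fun h => ?_
      have hinj : Set.InjOn (fun i => A i % q) (Finset.Ico (0 : ℤ) q : Set ℤ) :=
        Finset.card_image_iff.1 (by rw [← hT, h]; simp)
      have h1 : i % q = (i + 1) % q := by
        refine hinj ?_ ?_ ?_
        · simpa using ⟨Int.emod_nonneg _ hqz.ne', Int.emod_lt_of_pos _ hqz⟩
        · simpa using ⟨Int.emod_nonneg _ hqz.ne', Int.emod_lt_of_pos _ hqz⟩
        · simp only [hmod, hi']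
      have h2 : (q : ℤ) ∣ 1 := by
        have := Int.ModEq.dvd (show i ≡ i + 1 [ZMOD q] from h1)
        simpa using this
      have h3 : q = 1 := by
        have := Int.le_of_dvd one_pos h2
        omega
      have h4 := hA i
      rw [h3] at h4
      push_cast at h4
      omega
    -- The iterates start at `N + 1` so that all `q` of them have residues in the image `T`, which
    -- has fewer than `q`.
    obtain ⟨N, hN, M, hM, hne, heq⟩ := Finset.exists_ne_map_eq_of_card_lt_of_maps_to hcard
      (f := fun N => A^[N + 1] 0 % (q : ℤ)) (fun N _ => by
        simp only [Function.iterate_succ_apply']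
        exact hmem _)
    simp only [Finset.mem_range] at hN hM
    wlog hlt : N < M generalizing N M
    · exact this M N hne.symm heq.symm hM hN (by omega)
    obtain ⟨p, hp⟩ := Int.ModEq.dvd (show A^[N + 1] 0 ≡ A^[M + 1] 0 [ZMOD q] from heq)
    refine ⟨M - N, A^[N + 1] 0, p, by omega, by omega, ?_⟩
    rw [← Function.iterate_add_apply, show M - N + (N + 1) = M + 1 by omega]
    linarith

/-- A periodic orbit gives an equivariant sequence on which the map acts as a shift of indices. -/
theorem exists_sequence_of_periodic {A : ℤ → ℤ} {q k : ℕ} {j p : ℤ} (hk : 0 < k)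
    (hA : ∀ i, A (i + q) = A i + q) (hj : A^[k] j = j + p * q) :
    ∃ π : ℤ → ℤ, Monotone π ∧ (∀ l, π (l + k) = π l + q) ∧ ∀ l, A (π l) ≤ π (l + p) := by
  have hkz : (0 : ℤ) < k := by exact_mod_cast hk
  have hne : (Finset.range k).Nonempty := ⟨0, Finset.mem_range.2 hk⟩
  -- `A` sends the `i`-th term at `l` to the `(i + 1)`-st term at `l + p`; after the last one,
  -- `A^[k] j = j + p * q` closes the cycle.
  let term : ℤ → ℕ → ℤ := fun l i => A^[i] j + (l - i * p) / k * q
  let π : ℤ → ℤ := fun l => (Finset.range k).sup' hne (term l)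
  have hle : ∀ l i, i < k → term l i ≤ π l := fun l i hi =>
    Finset.le_sup' (term l) (Finset.mem_range.2 hi)
  have hex : ∀ l, ∃ i < k, π l = term l i := fun l => by
    obtain ⟨i, hi, h⟩ := Finset.exists_mem_eq_sup' hne (term l)
    exact ⟨i, Finset.mem_range.1 hi, h⟩
  have hshift : ∀ l i, term (l + k) i = term l i + q := by
    intro l i
    simp only [term]
    rw [show l + (k : ℤ) - i * p = (l - i * p) + 1 * k by ring,
      Int.add_mul_ediv_right _ _ hkz.ne']
    ring
  refine ⟨π, fun l l' h => ?_, fun l => ?_, fun l => ?_⟩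
  · obtain ⟨i, hi, hi'⟩ := hex l
    rw [hi']
    refine le_trans ?_ (hle l' i hi)
    simp only [term]
    have := Int.ediv_le_ediv hkz (show l - i * p ≤ l' - i * p by omega)
    have hq0 : (0 : ℤ) ≤ q := by positivity
    nlinarith
  · apply le_antisymm
    · obtain ⟨i, hi, hi'⟩ := hex (l + k)
      rw [hi', hshift]
      linarith [hle l i hi]
    · obtain ⟨i, hi, hi'⟩ := hex l
      rw [hi', ← hshift]
      exact hle _ i hi
  · obtain ⟨i, hi, hi'⟩ := hex l
    have h1 : A (π l) = A^[i + 1] j + (l - i * p) / k * q := by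
      rw [hi', Function.iterate_succ_apply']
      simpa using map_add_int_mul hA ((l - i * p) / k) (A^[i] j)
    rw [h1]
    rcases Nat.lt_or_ge (i + 1) k with h | h
    · refine le_trans (le_of_eq ?_) (hle (l + p) (i + 1) h)
      simp only [term]
      push_cast
      rw [show l + p - ((i : ℤ) + 1) * p = l - i * p by ring]
    · have hik : i + 1 = k := by omega
      refine le_trans (le_of_eq ?_) (hle (l + p) 0 hk)
      have hik' : (i : ℤ) = k - 1 := by omega
      simp only [term]
      rw [hik, hj, hik', show l - ((k : ℤ) - 1) * p = l + p + (-p) * k by ring,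
        Int.add_mul_ediv_right _ _ hkz.ne']
      simp
      ring

theorem fractions_comm (x y : ℝ) : fractions x y = fractions y x := by
  ext t
  constructor <;>
  · rintro ⟨p₁, p₂, q, hq, h₁, h₂, rfl⟩
    exact ⟨p₂, p₁, q, hq, h₂, h₁, by rw [add_comm (p₁ : ℝ)]⟩

/-- If `A` has rate at most `x` and the composition of `A` with the translation by `p + 1`, where
`p / q ≤ y`, has rate at least `c`, then some fraction is at least `c`. Replacing `A` by a
translation along one of its short periodic orbits exchanges the two maps and decreases `q`. -/
theorem exists_mem_fractions_of_growth {c : ℝ} (q : ℕ) (hq : 0 < q) (x y : ℝ) (A : ℤ → ℤ) (p : ℤ)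
    (hm : Monotone A) (hA : ∀ i, A (i + q) = A i + q) (hx : GrowthLE A (x * q))
    (hy : (p : ℝ) / q ≤ y) (hc : GrowthGE (fun j => A (j + (p + 1))) (c * q)) :
    ∃ t ∈ fractions x y, c ≤ t := by
  induction q using Nat.strong_induction_on generalizing x y A p with
  | _ q ih =>
  have hq' : (0 : ℝ) < q := by exact_mod_cast hq
  rcases exists_translation_or_short_orbit hq hm hA with ⟨s, hs⟩ | ⟨k, j, p', hk, hkq, hj⟩
  · have hiter : ∀ N : ℕ, A^[N] 0 = 0 + N * s := by
      intro N
      induction N with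
      | zero => simp
      | succ N ihN =>
        rw [Function.iterate_succ_apply', ihN, hs]
        push_cast
        ring
    refine ⟨((s : ℝ) + p + 1) / q, ⟨s, p, q, hq, ?_, hy, rfl⟩, ?_⟩
    · exact hx.le_of_iterate_eq hq hq hm hA (j := 0) (by rw [hiter]; ring)
    · obtain ⟨j, C, hC⟩ := hc
      have hiter' : ∀ N : ℕ, (fun j => A (j + (p + 1)))^[N] j = j + N * (s + p + 1) := by
        intro N
        induction N with
        | zero => simp
        | succ N ihN =>
          rw [Function.iterate_succ_apply', ihN, hs]
          push_cast
          ring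
      rw [le_div_iff₀ hq']
      by_contra! hlt
      obtain ⟨N, hN⟩ := exists_nat_gt ((j + C) / (c * q - (s + p + 1)))
      rw [div_lt_iff₀ (by linarith)] at hN
      have := hC N
      rw [hiter'] at this
      push_cast at this
      linarith
  · obtain ⟨π, hπm, hπ, hAπ⟩ := exists_sequence_of_periodic hk hA hj
    have hkz : (0 : ℤ) < k := by exact_mod_cast hk
    let u : ℤ → ℝ := fun l => π l
    have hum : Monotone u := fun a b h => by
      simp only [u]
      exact_mod_cast hπm h
    have hu : ∀ l, u (l + k) = u l + q := fun l => by
      simp only [u, hπ]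
      push_cast
      rfl
    obtain ⟨g, hg⟩ := exists_upper_adjoint hkz hq' hum hu
    -- `B` is translation by `p` rounded down to the orbit, so its rate is at most `(p / q) * k ≤ y
    -- * k`.
    let B : ℤ → ℤ := fun l => g (π l + p)
    have hB1 : ∀ l, π (B l) ≤ π l + p := fun l => by
      have := (hg (B l) (π l + p)).1 le_rfl
      simp only [u] at this
      exact_mod_cast this
    have hB2 : ∀ l, π l + p + 1 ≤ π (B l + 1) := fun l => by
      have := (hg (B l + 1) (π l + p)).not.1 (by simp [B])
      simp only [u, not_le] at this
      exact_mod_cast this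
    have hBm : Monotone B := fun a b h =>
      upper_adjoint_mono hg (by have := hum h; simp only [u] at this; linarith)
    have hBk : ∀ i, B (i + k) = B i + k := fun i => by
      have := upper_adjoint_add hu hg (π i + p)
      simp only [B]
      rw [← this, hπ]
      push_cast
      congr 1
      ring
    have hgr1 : GrowthLE B (y * k) := by
      have h1 : ∀ N : ℕ, π (B^[N] 0) ≤ p * N + π 0 := by
        intro N
        induction N with
        | zero => simp
        | succ N ihN =>
          rw [Function.iterate_succ_apply']
          have := hB1 (B^[N] 0)
          push_cast
          linarith
      obtain ⟨j₀, C, hC⟩ := growthLE_of_sequence (r := p) (C := π 0) hkz hq' hum hu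
        (B := B) (l := 0) (fun N => by
          simp only [u]
          exact_mod_cast h1 N)
      refine ⟨j₀, C, fun N => (hC N).trans ?_⟩
      push_cast
      gcongr
    have hgr2 : GrowthGE (fun l => B (l + (p' + 1))) (c * k) := by
      apply GrowthGE.conj_translation
      obtain ⟨i, C, hC⟩ := hc
      obtain ⟨l, hl⟩ : ∃ l, i ≤ π l := by
        refine ⟨g i + 1, ?_⟩
        have := (hg (g i + 1) i).not.1 (by simp)
        simp only [u, not_le] at this
        exact_mod_cast this.le
      have h1 : ∀ N : ℕ, (fun j => A (j + (p + 1)))^[N] i ≤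
          π ((fun l => B l + (p' + 1))^[N] l) := by
        intro N
        induction N with
        | zero => simpa using hl
        | succ N ihN =>
          rw [Function.iterate_succ_apply', Function.iterate_succ_apply']
          set w := (fun l => B l + (p' + 1))^[N] l
          -- The extra unit in `p + 1` pays for rounding up to `B w + 1` and reappears in `p' + 1`.
          calc A ((fun j => A (j + (p + 1)))^[N] i + (p + 1))
              ≤ A (π (B w + 1)) := hm (by linarith [hB2 w])
            _ ≤ π (B w + 1 + p') := hAπ _
            _ = π (B w + (p' + 1)) := by congr 1; ring
      have h2 := growthGE_of_sequence (r := c * q) (C := C) hkz hq' hum hu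
        (B := fun l => B l + (p' + 1)) (l := l) (fun N => by
          refine (hC N).trans ?_
          simp only [u]
          exact_mod_cast h1 N)
      rwa [mul_div_cancel_right₀ _ hq'.ne'] at h2
    have hp' : (p' : ℝ) / k ≤ x := hx.le_of_iterate_eq hq hk hm hA hj
    rw [fractions_comm]
    exact ih k hkq hk y x B p' hBm hBk hgr1 hp' hgr2

end Discrete

/-! ### From circle lifts to integer maps -/

section UpperBound

/-- A map with translation number greater than `m / n` moves the terms of some equivariant
sequence at least `m` places forward. -/
theorem exists_sequence_of_lt_translationNumber (g : CircleDeg1Lift) {n : ℕ} {m : ℤ} (hn : 0 < n)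
    (h : (m : ℝ) / n < translationNumber g) :
    ∃ ζ : ℤ → ℝ, Monotone ζ ∧ (∀ i, ζ (i + n) = ζ i + 1) ∧ ∀ i, ζ (i + m) ≤ g (ζ i) := by
  have hn' : (0 : ℝ) < n := by exact_mod_cast hn
  have hne : (Finset.range n).Nonempty := ⟨0, Finset.mem_range.2 hn⟩
  have hpow : ∀ z, z + m < (g ^ n) z := by
    refine lt_map_of_int_lt_translationNumber _ ?_
    rw [translationNumber_pow]
    rwa [div_lt_iff₀' hn'] at h
  -- Taking the minimum over `k < n` makes `g` advance indices by `m`; the cycle closes because `g ^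
  -- n` moves every point by more than `m`.
  let term : ℤ → ℕ → ℝ := fun i k => (g ^ k) ((i - k * m) / n)
  let ζ : ℤ → ℝ := fun i => (Finset.range n).inf' hne (term i)
  have hle : ∀ i k, k < n → ζ i ≤ term i k := fun i k hk =>
    Finset.inf'_le (term i) (Finset.mem_range.2 hk)
  have hex : ∀ i, ∃ k < n, ζ i = term i k := fun i => by
    obtain ⟨k, hk, h⟩ := Finset.exists_mem_eq_inf' hne (term i)
    exact ⟨k, Finset.mem_range.1 hk, h⟩
  have hshift : ∀ i k, term (i + n) k = term i k + 1 := by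
    intro i k
    simp only [term]
    rw [← map_add_one]
    congr 1
    push_cast
    field_simp
    ring
  refine ⟨ζ, fun i i' hi => ?_, fun i => ?_, fun i => ?_⟩
  · obtain ⟨k, hk, hk'⟩ := hex i'
    rw [hk']
    refine (hle i k hk).trans ((g ^ k).monotone ?_)
    have : (i : ℝ) ≤ i' := by exact_mod_cast hi
    gcongr
  · apply le_antisymm
    · obtain ⟨k, hk, hk'⟩ := hex i
      rw [hk', ← hshift]
      exact hle _ k hk
    · obtain ⟨k, hk, hk'⟩ := hex (i + n)
      rw [hk', hshift]
      linarith [hle i k hk]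
  · obtain ⟨k, hk, hk'⟩ := hex i
    have h1 : g (ζ i) = (g ^ (k + 1)) ((i - k * m) / n) := by
      rw [hk', pow_succ', mul_apply]
    rw [h1]
    rcases Nat.lt_or_ge (k + 1) n with h | h
    · refine (hle (i + m) (k + 1) h).trans (le_of_eq ?_)
      simp only [term]
      congr 1
      push_cast
      ring
    · have hkn : k + 1 = n := by omega
      refine (hle (i + m) 0 hn).trans ?_
      have hkn' : (k : ℝ) = n - 1 := by
        rw [← hkn]
        push_cast
        ring
      rw [hkn]
      refine le_trans (le_of_eq ?_) (hpow _).le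
      simp only [term, hkn']
      simp
      field_simp
      ring

/-- By induction `u (B^[N] 0) ≤ (a ^ N) (u 0)`, and the right side is within `1` of `u 0 + N *
translationNumber a`. -/
theorem growthLE_of_le_map {u : ℤ → ℝ} {k : ℤ} (hk : 0 < k) (hm : Monotone u)
    (hu : ∀ i, u (i + k) = u i + 1) {B : ℤ → ℤ} (a : CircleDeg1Lift)
    (h : ∀ l, u (B l) ≤ a (u l)) : GrowthLE B (translationNumber a * k) := by
  have h1 : ∀ N : ℕ, u (B^[N] 0) ≤ (a ^ N) (u 0) := by
    intro N
    induction N with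
    | zero => simp
    | succ N ih =>
      rw [Function.iterate_succ_apply', pow_succ', mul_apply]
      exact (h _).trans (a.monotone ih)
  have h2 := growthLE_of_sequence (r := translationNumber a) (C := u 0 + 1) hk one_pos hm hu
    (B := B) (l := 0) (fun N => by
      have := (a ^ N).map_lt_add_translationNumber_add_one (u 0)
      rw [translationNumber_pow] at this
      linarith [h1 N])
  rwa [div_one] at h2

/-- Every rational number below the translation number of a product is bounded by a fraction
built from the translation numbers of the factors. -/
theorem exists_mem_fractions_of_lt_translationNumber (a b : CircleDeg1Lift) {n : ℕ} {m : ℤ}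
    (hn : 0 < n) (h : (m : ℝ) / n < translationNumber (a * b)) :
    ∃ t ∈ fractions (translationNumber a) (translationNumber b), (m : ℝ) / n ≤ t := by
  have hn' : (0 : ℝ) < n := by exact_mod_cast hn
  have hnz : (0 : ℤ) < n := by exact_mod_cast hn
  obtain ⟨ζ, hζm, hζ, hab⟩ := exists_sequence_of_lt_translationNumber (a * b) hn h
  have hbm : Monotone fun i => b (ζ i) := b.monotone.comp hζm
  have hb : ∀ i, b (ζ (i + n)) = b (ζ i) + 1 := fun i => by rw [hζ, map_add_one]
  obtain ⟨f, hf⟩ := exists_upper_adjoint hnz one_pos hbm hb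
  -- For `i = f (ζ j)`, `ζ (i + m) ≤ a (b (ζ i)) ≤ a (ζ j)`.
  let F : ℤ → ℤ := fun j => f (ζ j) + m
  have hFm : Monotone F := fun i j hij => by
    simp only [F]
    gcongr
    exact upper_adjoint_mono hf (hζm hij)
  have hF : ∀ i, F (i + n) = F i + n := fun i => by
    simp only [F]
    rw [hζ, upper_adjoint_add hb hf]
    ring
  have hFa : GrowthLE F (translationNumber a * n) := by
    refine growthLE_of_le_map hnz hζm hζ a fun j => (hab _).trans ?_
    rw [mul_apply]
    exact a.monotone ((hf _ _).1 le_rfl)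
  obtain ⟨k, j, p, hk, hj⟩ : ∃ (k : ℕ) (j p : ℤ), 0 < k ∧ F^[k] j = j + p * n := by
    rcases exists_translation_or_short_orbit hn hFm hF with ⟨s, hs⟩ | ⟨k, j, p, hk, -, hj⟩
    · refine ⟨n, 0, s, hn, ?_⟩
      have : F = fun j => j + s := funext hs
      rw [this, add_right_iterate]
      simp [mul_comm]
    · exact ⟨k, j, p, hk, hj⟩
  have hp : (p : ℝ) / k ≤ translationNumber a := hFa.le_of_iterate_eq hn hk hFm hF hj
  obtain ⟨π, hπm, hπ, hFπ⟩ := exists_sequence_of_periodic hk hF hj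
  have hkz : (0 : ℤ) < k := by exact_mod_cast hk
  let u : ℤ → ℝ := fun l => π l
  have hum : Monotone u := fun a b h => by
    simp only [u]
    exact_mod_cast hπm h
  have hu : ∀ l, u (l + k) = u l + n := fun l => by
    simp only [u, hπ]
    push_cast
    rfl
  obtain ⟨g, hg⟩ := exists_upper_adjoint hkz hn' hum hu
  -- The `- 1` makes `π (B l + p) < π l + m` strict, which is what gives `ζ (π (B l)) < b (ζ (π l))`
  -- below.
  let B : ℤ → ℤ := fun l => g (π l + m - 1) - p
  have hB1 : ∀ l, π (B l + p) < π l + m := fun l => by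
    have := (hg (B l + p) (π l + m - 1)).1 (by simp [B])
    simp only [u] at this
    have h2 : π (B l + p) ≤ π l + m - 1 := by exact_mod_cast this
    omega
  have hB2 : ∀ l, π l + m ≤ π (B l + (p + 1)) := fun l => by
    have := (hg (B l + (p + 1)) (π l + m - 1)).not.1 (by simp [B]; omega)
    simp only [u, not_le] at this
    have h2 : π l + m - 1 < π (B l + (p + 1)) := by exact_mod_cast this
    omega
  have hBm : Monotone B := fun i j hij => by
    simp only [B]
    gcongr
    refine upper_adjoint_mono hg ?_
    have := hum hij
    simp only [u] at this
    linarith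
  have hB : ∀ i, B (i + k) = B i + k := fun i => by
    have := upper_adjoint_add hu hg (π i + m - 1)
    simp only [B]
    rw [show g (π (i + k) + m - 1) = g (π i + m - 1 + n) by
      rw [hπ]; push_cast; congr 1; ring, this]
    ring
  have hgr1 : GrowthLE B (translationNumber b * k) := by
    refine growthLE_of_le_map (u := fun l => ζ (π l)) hkz (hζm.comp hπm)
      (fun i => by rw [hπ, hζ]) b fun l => ?_
    have h1 : F (π (B l)) < π l + m := (hFπ _).trans_lt (hB1 l)
    have h2 : ¬ π l ≤ f (ζ (π (B l))) := by
      simp only [F] at h1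
      omega
    exact (not_le.1 ((hf _ _).not.1 h2)).le
  have hgr2 : GrowthGE (fun l => B (l + (p + 1))) ((m : ℝ) / n * k) := by
    apply GrowthGE.conj_translation
    have h1 : ∀ N : ℕ, π 0 + m * N ≤ π ((fun l => B l + (p + 1))^[N] 0) := by
      intro N
      induction N with
      | zero => simp
      | succ N ih =>
        rw [Function.iterate_succ_apply']
        have := hB2 ((fun l => B l + (p + 1))^[N] 0)
        push_cast
        linarith
    exact growthGE_of_sequence (r := m) (C := -π 0) hkz hn' hum hu
      (B := fun l => B l + (p + 1)) (l := 0) (fun N => by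
        have h2 : (π 0 : ℝ) + m * N ≤ u ((fun l => B l + (p + 1))^[N] 0) := by
          simp only [u]
          exact_mod_cast h1 N
        linarith)
  rw [fractions_comm]
  exact exists_mem_fractions_of_growth k hk _ _ B p hBm hB hgr1 hp hgr2

end UpperBound

/-! ### The fractions have a maximum -/

section Maximum

open Filter Topology in
/-- Multiples of two real numbers are simultaneously close to integers. -/
theorem exists_mul_near_int (x y : ℝ) {ε : ℝ} (hε : 0 < ε) :
    ∃ n : ℕ, 2 ≤ n ∧ ∃ P R : ℤ, |n * x - P| < ε ∧ |n * y - R| < ε := by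
  have h := mapClusterPt_zero_atTop_nsmul ((x, y) : UnitAddCircle × UnitAddCircle)
  have h1 := (h.frequently (Metric.ball_mem_nhds _ hε)).and_eventually (eventually_ge_atTop 2)
  obtain ⟨n, hn, h2⟩ := h1.exists
  rw [dist_zero_right, Prod.norm_def, max_lt_iff] at hn
  refine ⟨n, h2, round (n * x), round (n * y), ?_, ?_⟩
  · have := hn.1
    rwa [Prod.smul_fst, ← AddCircle.coe_nsmul, UnitAddCircle.norm_eq, nsmul_eq_mul] at this
  · have := hn.2
    rwa [Prod.smul_snd, ← AddCircle.coe_nsmul, UnitAddCircle.norm_eq, nsmul_eq_mul] at this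

/-- If no fraction exceeds `x + y`, then `x + y` is the fraction with denominator one. -/
theorem floor_add_floor_add_one_eq {x y : ℝ} (h : ∀ t ∈ fractions x y, t ≤ x + y) :
    (⌊x⌋ : ℝ) + ⌊y⌋ + 1 = x + y := by
  have h1 : (⌊x⌋ : ℝ) + ⌊y⌋ + 1 ≤ x + y := by
    refine h _ ⟨⌊x⌋, ⌊y⌋, 1, one_pos, ?_, ?_, by simp⟩ <;> simp [Int.floor_le]
  by_contra hne
  have h2 : (⌊x⌋ : ℝ) + ⌊y⌋ + 1 < x + y := lt_of_le_of_ne h1 hne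
  have hx := Int.lt_floor_add_one x
  have hy := Int.lt_floor_add_one y
  -- The first two bounds on `ε` make `P - ⌊x⌋ - 1` and `R - ⌊y⌋ - 1` admissible numerators over `n
  -- - 1`; the third makes their fraction exceed `x + y`.
  obtain ⟨n, hn, P, R, hP, hR⟩ := exists_mul_near_int x y
    (ε := min (min (⌊x⌋ + 1 - x) (⌊y⌋ + 1 - y)) ((x + y - (⌊x⌋ + ⌊y⌋ + 1)) / 2))
    (by simp only [lt_min_iff]; refine ⟨⟨?_, ?_⟩, ?_⟩ <;> linarith)
  simp only [lt_min_iff, abs_lt] at hP hR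
  have hn1 : (0 : ℝ) < (n - 1 : ℕ) := by exact_mod_cast (by omega : 0 < n - 1)
  have hcast : ((n - 1 : ℕ) : ℝ) = n - 1 := by
    rw [Nat.cast_sub (by omega)]
    simp
  have h3 := h (((P - ⌊x⌋ - 1 : ℤ) + (R - ⌊y⌋ - 1 : ℤ) + 1 : ℝ) / (n - 1 : ℕ))
    ⟨P - ⌊x⌋ - 1, R - ⌊y⌋ - 1, n - 1, by omega, by
      rw [div_le_iff₀ hn1, hcast]
      push_cast
      linarith [hP.1.1], by
      rw [div_le_iff₀ hn1, hcast]
      push_cast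
      linarith [hR.1.2], rfl⟩
  rw [div_le_iff₀ hn1, hcast] at h3
  push_cast at h3
  linarith [hP.2, hR.2]

theorem exists_isGreatest_fractions (x y : ℝ) : ∃ M, IsGreatest (fractions x y) M := by
  by_cases h : ∀ t ∈ fractions x y, t ≤ x + y
  · refine ⟨x + y, ⟨⌊x⌋, ⌊y⌋, 1, one_pos, ?_, ?_, ?_⟩, h⟩
    · simp [Int.floor_le]
    · simp [Int.floor_le]
    · simp [floor_add_floor_add_one_eq h]
  · push Not at h
    obtain ⟨t, ht, hlt⟩ := h
    let v : ℕ → ℝ := fun q => ((⌊q * x⌋ : ℝ) + ⌊q * y⌋ + 1) / q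
    have hv : ∀ q, 0 < q → v q ∈ fractions x y := fun q hq => by
      have hq' : (0 : ℝ) < q := by exact_mod_cast hq
      refine ⟨⌊q * x⌋, ⌊q * y⌋, q, hq, ?_, ?_, rfl⟩ <;> rw [div_le_iff₀' hq'] <;>
        exact Int.floor_le _
    have hle : ∀ s ∈ fractions x y, ∃ q : ℕ, 0 < q ∧ s ≤ v q ∧ s ≤ x + y + 1 / q := by
      rintro s ⟨p₁, p₂, q, hq, h₁, h₂, rfl⟩
      have hq' : (0 : ℝ) < q := by exact_mod_cast hq
      refine ⟨q, hq, ?_, ?_⟩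
      · rw [div_le_iff₀' hq'] at h₁ h₂
        have h₁' : (p₁ : ℝ) ≤ ⌊q * x⌋ := by exact_mod_cast Int.le_floor.2 h₁
        have h₂' : (p₂ : ℝ) ≤ ⌊q * y⌋ := by exact_mod_cast Int.le_floor.2 h₂
        simp only [v]
        gcongr
      · rw [add_div, add_div]
        gcongr
    obtain ⟨Q, hQ⟩ := exists_nat_gt (1 / (t - (x + y)))
    have hbig : ∀ q : ℕ, Q < q → x + y + 1 / q < t := fun q hq => by
      have hq' : (Q : ℝ) < q := by exact_mod_cast hq
      have hpos : 0 < t - (x + y) := by linarith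
      have h0 : (0 : ℝ) < q := (one_div_pos.2 hpos).trans (hQ.trans hq')
      have : 1 / (q : ℝ) < t - (x + y) := (one_div_lt hpos h0).1 (hQ.trans hq')
      linarith
    have hsmall : ∀ s ∈ fractions x y, t ≤ s → ∃ q ∈ Finset.Icc 1 Q, s ≤ v q := fun s hs hts => by
      obtain ⟨q, hq, h1, h2⟩ := hle s hs
      refine ⟨q, Finset.mem_Icc.2 ⟨hq, ?_⟩, h1⟩
      by_contra! hlt
      linarith [hbig q hlt]
    obtain ⟨q₀, hq₀, htq₀⟩ := hsmall t ht le_rfl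
    obtain ⟨q, hq, hmax⟩ := Finset.exists_max_image (Finset.Icc 1 Q) v ⟨q₀, hq₀⟩
    refine ⟨v q, hv q (Finset.mem_Icc.1 hq).1, fun s hs => ?_⟩
    rcases le_total t s with hts | hst
    · obtain ⟨q', hq', h'⟩ := hsmall s hs hts
      exact h'.trans (hmax q' hq')
    · exact hst.trans (htq₀.trans (hmax q₀ hq₀))

end Maximum

/-! ### Extremal pairs and monotonicity in the translation numbers -/

section LowerBound

/-- The lift of the circle map that is given on `[0, 1)` by `φ`. -/
noncomputable def liftIco (φ : ℝ → ℝ) (hφ : Monotone φ)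
    (h : ∀ s ∈ Set.Ico (0 : ℝ) 1, φ s ∈ Set.Ico (0 : ℝ) 1) : CircleDeg1Lift where
  toFun t := ⌊t⌋ + φ (Int.fract t)
  monotone' t t' htt' := by
    have hfr : ∀ t : ℝ, φ (Int.fract t) ∈ Set.Ico (0 : ℝ) 1 := fun t =>
      h _ ⟨Int.fract_nonneg t, Int.fract_lt_one t⟩
    rcases (Int.floor_mono htt').eq_or_lt with he | hlt
    · have : Int.fract t ≤ Int.fract t' := by
        rw [Int.fract, Int.fract, he]
        linarith
      simp only [he]
      gcongr
      exact hφ this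
    · have : (⌊t⌋ : ℝ) + 1 ≤ ⌊t'⌋ := by exact_mod_cast hlt
      linarith [(hfr t).2, (hfr t').1]
  map_add_one' t := by
    rw [Int.floor_add_one, Int.fract_add_one]
    push_cast
    ring

theorem liftIco_apply {φ : ℝ → ℝ} (hφ : Monotone φ)
    (h : ∀ s ∈ Set.Ico (0 : ℝ) 1, φ s ∈ Set.Ico (0 : ℝ) 1) (t : ℝ) :
    liftIco φ hφ h t = ⌊t⌋ + φ (Int.fract t) :=
  rfl

theorem liftIco_liftIco {φ ψ : ℝ → ℝ} (hφ : Monotone φ)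
    (h : ∀ s ∈ Set.Ico (0 : ℝ) 1, φ s ∈ Set.Ico (0 : ℝ) 1) (hψ : Monotone ψ)
    (h' : ∀ s ∈ Set.Ico (0 : ℝ) 1, ψ s ∈ Set.Ico (0 : ℝ) 1) (hinv : ∀ s, φ (ψ s) = s) :
    liftIco φ hφ h * liftIco ψ hψ h' = 1 := by
  ext t
  have hs := h' _ ⟨Int.fract_nonneg t, Int.fract_lt_one t⟩
  rw [mul_apply, liftIco_apply, liftIco_apply, Int.floor_intCast_add, Int.fract_intCast_add,
    Int.floor_eq_zero_iff.2 hs, Int.fract_eq_self.2 hs, hinv]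
  simp [Int.floor_add_fract]

/-- A lift of a piecewise linear circle homeomorphism which fixes `0` and maps `1 / 4`
to `3 / 4`. -/
noncomputable def kink : CircleDeg1Liftˣ where
  val := liftIco (fun s => min (3 * s) ((s + 2) / 3))
    (fun s t h => by dsimp only; gcongr)
    (fun s hs => ⟨le_min (by linarith [hs.1]) (by linarith [hs.1]),
      min_lt_of_right_lt (by linarith [hs.2])⟩)
  inv := liftIco (fun s => max (s / 3) (3 * s - 2))
    (fun s t h => by dsimp only; gcongr)
    (fun s hs => ⟨le_max_of_le_left (by linarith [hs.1]),
      max_lt (by linarith [hs.1, hs.2]) (by linarith [hs.2])⟩)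
  val_inv := liftIco_liftIco _ _ _ _ fun s => by
    rcases le_total (s / 3) (3 * s - 2) with h | h
    · rw [max_eq_right h, min_eq_right (by linarith)]
      ring
    · rw [max_eq_left h, min_eq_left (by linarith)]
      ring
  inv_val := liftIco_liftIco _ _ _ _ fun s => by
    rcases le_total (3 * s) ((s + 2) / 3) with h | h
    · rw [min_eq_left h, max_eq_left (by linarith)]
      ring
    · rw [min_eq_right h, max_eq_right (by linarith)]
      ring

theorem kink_apply (t : ℝ) :
    kink t = ⌊t⌋ + min (3 * Int.fract t) ((Int.fract t + 2) / 3) :=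
  rfl

/-- The conjugate of a lift by the multiplication by `q`. -/
noncomputable def rescale (q : ℕ) (hq : 0 < q) (f : CircleDeg1Lift) : CircleDeg1Lift where
  toFun t := f (q * t) / q
  monotone' s t h := by
    dsimp only
    gcongr
  map_add_one' t := by
    have hq' : (q : ℝ) ≠ 0 := by exact_mod_cast hq.ne'
    rw [mul_add, mul_one, map_add_nat]
    field_simp

theorem rescale_apply (q : ℕ) (hq : 0 < q) (f : CircleDeg1Lift) (t : ℝ) :
    rescale q hq f t = f (q * t) / q :=
  rfl

theorem rescale_mul_rescale {q : ℕ} (hq : 0 < q) {f g : CircleDeg1Lift} (h : f * g = 1) :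
    rescale q hq f * rescale q hq g = 1 := by
  have hq' : (q : ℝ) ≠ 0 := by exact_mod_cast hq.ne'
  ext t
  have := DFunLike.congr_fun h (q * t)
  rw [mul_apply] at this
  rw [mul_apply, rescale_apply, rescale_apply, mul_div_cancel₀ _ hq', this]
  simp [hq']

noncomputable def rescaleUnit (q : ℕ) (hq : 0 < q) (f : CircleDeg1Liftˣ) : CircleDeg1Liftˣ where
  val := rescale q hq f
  inv := rescale q hq (f⁻¹ : CircleDeg1Liftˣ)
  val_inv := rescale_mul_rescale hq f.mul_inv
  inv_val := rescale_mul_rescale hq f.inv_mul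

theorem rescaleUnit_apply (q : ℕ) (hq : 0 < q) (f : CircleDeg1Liftˣ) (t : ℝ) :
    rescaleUnit q hq f t = f (q * t) / q :=
  rfl

/-- The translation by `r` as an invertible lift. -/
noncomputable abbrev trans (r : ℝ) : CircleDeg1Liftˣ :=
  translate (Multiplicative.ofAdd r)

theorem trans_mul_trans (r s : ℝ) : trans r * trans s = trans (r + s) := by
  rw [trans, trans, ← map_mul, ← ofAdd_add]

theorem commute_trans_trans (r s : ℝ) : Commute (trans r) (trans s) := by
  rw [Commute, SemiconjBy, trans_mul_trans, trans_mul_trans, add_comm]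

theorem commute_trans_rescaleUnit (q : ℕ) (hq : 0 < q) (f : CircleDeg1Liftˣ) (p : ℤ) :
    Commute (trans (p / q)) (rescaleUnit q hq f) := by
  have hq' : (q : ℝ) ≠ 0 := by exact_mod_cast hq.ne'
  ext t
  simp only [Units.val_mul, mul_apply, CircleDeg1Lift.translate_apply, rescaleUnit_apply]
  rw [mul_add, mul_div_cancel₀ _ hq', map_int_add]
  ring

theorem translationNumber_trans_mul {r : ℝ} {f : CircleDeg1Liftˣ} (h : Commute (trans r) f) :
    translationNumber ((trans r * f : CircleDeg1Liftˣ) : CircleDeg1Lift) =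
      r + translationNumber (f : CircleDeg1Lift) := by
  rw [Units.val_mul, translationNumber_mul_of_commute, translationNumber_translate]
  have := congrArg Units.val h.eq
  simpa only [Commute, SemiconjBy, Units.val_mul] using this

/-- The extremal pair for two rotation numbers with the same denominator. -/
theorem exists_pair_of_rational (p₁ p₂ : ℤ) (q : ℕ) (hq : 0 < q) :
    ∃ a b : CircleDeg1Liftˣ, translationNumber (a : CircleDeg1Lift) = p₁ / q ∧
      translationNumber (b : CircleDeg1Lift) = p₂ / q ∧
      translationNumber ((a * b : CircleDeg1Liftˣ) : CircleDeg1Lift) = (p₁ + p₂ + 1) / q := by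
  have hq' : (q : ℝ) ≠ 0 := by exact_mod_cast hq.ne'
  set U := rescaleUnit q hq kink with hU
  set S := trans (1 / (2 * q)) with hS
  -- The half-period shift makes the kinks chain: in units of `1 / q`, `V` sends `3/4` to `5/4` and
  -- `U` sends `5/4` to `7/4`, a net advance of `1`.
  set V := S * U * S⁻¹ with hV
  have hTU : ∀ p : ℤ, Commute (trans (p / q)) U := commute_trans_rescaleUnit q hq kink
  have hTS : ∀ r, Commute (trans r) S := fun r => commute_trans_trans _ _
  have hTV : ∀ p : ℤ, Commute (trans (p / q)) V := fun p =>
    ((hTS _).mul_right (hTU p)).mul_right (hTS _).inv_right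
  have hU0 : translationNumber (U : CircleDeg1Lift) = 0 := by
    have : (U : CircleDeg1Lift) 0 = 0 + (0 : ℤ) := by
      rw [hU, rescaleUnit_apply, kink_apply]
      simp [show (0 : ℝ) ≤ 2 / 3 by norm_num]
    simpa using translationNumber_of_eq_add_int _ this
  have hV0 : translationNumber (V : CircleDeg1Lift) = 0 := by
    rw [hV, Units.val_mul, Units.val_mul, translationNumber_conj_eq, hU0]
  have hUV0 : translationNumber ((trans ((-1 : ℤ) / q) * (U * V) : CircleDeg1Liftˣ) :
      CircleDeg1Lift) = 0 := by
    have : ((trans ((-1 : ℤ) / q) * (U * V) : CircleDeg1Liftˣ) : CircleDeg1Lift) (3 / 4 / q) =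
        3 / 4 / q + (0 : ℤ) := by
      have e1 : (q : ℝ) * (-(1 / (2 * q)) + 3 / 4 / q) = 1 / 4 := by
        field_simp
        norm_num
      have e2 : kink (1 / 4) = 3 / 4 := by
        rw [kink_apply, Int.floor_eq_zero_iff.2 (by norm_num), Int.fract_eq_self.2 (by norm_num)]
        norm_num
      have e3 : (q : ℝ) * (1 / (2 * q) + 3 / 4 / q) = ((1 : ℤ) : ℝ) + 1 / 4 := by
        field_simp
        norm_num
      simp only [hV, hU, hS, Units.val_mul, mul_apply, CircleDeg1Lift.translate_apply,
        translate_inv_apply, rescaleUnit_apply]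
      rw [e1, e2, e3, map_int_add, e2]
      field_simp
      norm_num
    simpa using translationNumber_of_eq_add_int _ this
  refine ⟨trans (p₁ / q) * U, trans (p₂ / q) * V, ?_, ?_, ?_⟩
  · rw [translationNumber_trans_mul (hTU p₁), hU0, add_zero]
  · rw [translationNumber_trans_mul (hTV p₂), hV0, add_zero]
  · have hcomm : ∀ p : ℤ, Commute (trans (p / q)) (U * V) := fun p =>
      (hTU p).mul_right (hTV p)
    rw [translationNumber_trans_mul (hcomm (-1))] at hUV0
    have e : trans (p₁ / q) * U * (trans (p₂ / q) * V) =
        trans ((p₁ + p₂ : ℤ) / q) * (U * V) := by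
      rw [mul_assoc, ← mul_assoc U, ← (hTU p₂).eq, mul_assoc, ← mul_assoc (trans _) (trans _),
        trans_mul_trans]
      push_cast
      rw [add_div]
    rw [e, translationNumber_trans_mul (hcomm _)]
    push_cast at hUV0 ⊢
    linear_combination hUV0

theorem continuous_units (a : CircleDeg1Liftˣ) : Continuous (a : CircleDeg1Lift) :=
  (toOrderIso a).continuous

theorem continuous_trans_mul_pow (a : CircleDeg1Liftˣ) (n : ℕ) :
    Continuous fun t : ℝ => (((trans t * a : CircleDeg1Liftˣ) : CircleDeg1Lift) ^ n) 0 := by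
  induction n with
  | zero => simpa using continuous_const
  | succ n ih =>
    simp only [pow_succ', mul_apply, Units.val_mul, CircleDeg1Lift.translate_apply] at ih ⊢
    exact continuous_id.add ((continuous_units a).comp ih)

-- Comparing the translation number with a rational amounts to comparing a fixed iterate at `0` with
-- an integer, an open condition in `t` when strict.
open Filter Topology in
theorem continuous_translationNumber_trans_mul (a : CircleDeg1Liftˣ) :
    Continuous fun t : ℝ =>
      translationNumber ((trans t * a : CircleDeg1Liftˣ) : CircleDeg1Lift) := by
  refine continuous_iff_continuousAt.2 fun t₀ => tendsto_order.2 ⟨fun c hc => ?_, fun c hc => ?_⟩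
  · obtain ⟨r, hcr, hr⟩ := exists_rat_btwn hc
    have hpos : (0 : ℝ) < r.den := by exact_mod_cast r.den_pos
    rw [Rat.cast_def] at hcr hr
    have h1 : (r.num : ℝ) <
        (((trans t₀ * a : CircleDeg1Liftˣ) : CircleDeg1Lift) ^ r.den) 0 := by
      have := lt_map_of_int_lt_translationNumber
        (((trans t₀ * a : CircleDeg1Liftˣ) : CircleDeg1Lift) ^ r.den) (n := r.num)
        (by rw [translationNumber_pow]; rwa [div_lt_iff₀' hpos] at hr) 0
      simpa using this
    filter_upwards [(continuous_trans_mul_pow a r.den).continuousAt.eventually (lt_mem_nhds h1)]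
      with t ht
    have h2 := le_translationNumber_of_add_int_le
      (((trans t * a : CircleDeg1Liftˣ) : CircleDeg1Lift) ^ r.den) (x := 0) (m := r.num)
      (by rw [zero_add]; exact ht.le)
    rw [translationNumber_pow, ← div_le_iff₀' hpos] at h2
    exact hcr.trans_le h2
  · obtain ⟨r, hr, hcr⟩ := exists_rat_btwn hc
    have hpos : (0 : ℝ) < r.den := by exact_mod_cast r.den_pos
    rw [Rat.cast_def] at hcr hr
    have h1 : (((trans t₀ * a : CircleDeg1Liftˣ) : CircleDeg1Lift) ^ r.den) 0 < r.num := by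
      have := map_lt_of_translationNumber_lt_int
        (((trans t₀ * a : CircleDeg1Liftˣ) : CircleDeg1Lift) ^ r.den) (n := r.num)
        (by rw [translationNumber_pow]; rwa [lt_div_iff₀' hpos] at hr) 0
      simpa using this
    filter_upwards [(continuous_trans_mul_pow a r.den).continuousAt.eventually (gt_mem_nhds h1)]
      with t ht
    have h2 := translationNumber_le_of_le_add_int
      (((trans t * a : CircleDeg1Liftˣ) : CircleDeg1Lift) ^ r.den) (x := 0) (m := r.num)
      (by rw [zero_add]; exact ht.le)
    rw [translationNumber_pow, ← le_div_iff₀' hpos] at h2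
    exact h2.trans_lt hcr

/-- The translation number can be raised to any larger value by composing with a translation. -/
theorem exists_ge_translationNumber_eq (a : CircleDeg1Liftˣ) {x : ℝ}
    (h : translationNumber (a : CircleDeg1Lift) ≤ x) :
    ∃ a' : CircleDeg1Liftˣ, (∀ t, a t ≤ a' t) ∧
      translationNumber (a' : CircleDeg1Lift) = x := by
  obtain ⟨n, hn⟩ := exists_nat_ge (x - translationNumber (a : CircleDeg1Lift))
  have h0 : translationNumber ((trans 0 * a : CircleDeg1Liftˣ) : CircleDeg1Lift) ≤ x := by
    simpa [trans] using h
  have h1 : x ≤ translationNumber ((trans n * a : CircleDeg1Liftˣ) : CircleDeg1Lift) := by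
    rw [translationNumber_trans_mul]
    · linarith
    · ext t
      simp [Units.val_mul, mul_apply]
  obtain ⟨t, ht, htx⟩ := intermediate_value_Icc (Nat.cast_nonneg n)
    (continuous_translationNumber_trans_mul a).continuousOn ⟨h0, h1⟩
  refine ⟨trans t * a, fun s => ?_, htx⟩
  rw [Units.val_mul, mul_apply, CircleDeg1Lift.translate_apply]
  linarith [ht.1]

/-- The extremal pair for `p₁ / q ≤ x`, `p₂ / q ≤ y` is raised pointwise to translation numbers `x`
and `y`, and the translation number of the product is monotone. -/
theorem fraction_le_Rab {x y t : ℝ} (ht : t ∈ fractions x y) : t ≤ Rab x y := by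
  obtain ⟨p₁, p₂, q, hq, h₁, h₂, rfl⟩ := ht
  obtain ⟨a, b, ha, hb, hab⟩ := exists_pair_of_rational p₁ p₂ q hq
  obtain ⟨a', haa', ha'⟩ := exists_ge_translationNumber_eq a (ha.trans_le h₁)
  obtain ⟨b', hbb', hb'⟩ := exists_ge_translationNumber_eq b (hb.trans_le h₂)
  rw [← hab]
  refine le_trans (translationNumber_mono fun t => ?_)
    ((isLUB_Rab x y).1 ⟨a', b', ha', hb', rfl⟩)
  change a (b t) ≤ a' (b' t)
  exact (haa' _).trans ((a' : CircleDeg1Lift).monotone (hbb' t))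

end LowerBound

theorem isGreatest_fractions_Rab (x y : ℝ) : IsGreatest (fractions x y) (Rab x y) := by
  obtain ⟨M, hM⟩ := exists_isGreatest_fractions x y
  suffices h : Rab x y = M by rwa [h]
  refine le_antisymm ((isLUB_Rab x y).2 ?_) (fraction_le_Rab hM.1)
  rintro t ⟨a, b, rfl, rfl, rfl⟩
  -- Passing to rationals strictly below supplies the strict inequality needed to discretize.
  refine le_of_forall_rat_lt_imp_le fun r hr => ?_
  rw [Rat.cast_def] at hr ⊢
  rw [Units.val_mul] at hr
  obtain ⟨s, hs, hrs⟩ := exists_mem_fractions_of_lt_translationNumber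
    (a : CircleDeg1Lift) (b : CircleDeg1Lift) r.den_pos hr
  exact hrs.trans (hM.2 hs)

end Ziggurat

theorem proposition3 :
    (∀ x y : ℝ, ∃ r : ℚ, Ziggurat.Rab x y = (r : ℝ)) ∧
    (∀ x y : ℝ, IsGreatest (Ziggurat.fractions x y) (Ziggurat.Rab x y)) := by
  refine ⟨fun x y => ?_, Ziggurat.isGreatest_fractions_Rab⟩
  obtain ⟨p₁, p₂, q, -, -, -, h⟩ := (Ziggurat.isGreatest_fractions_Rab x y).1
  exact ⟨((p₁ : ℚ) + p₂ + 1) / q, by rw [h]; push_cast; rfl⟩
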